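/- Let $A$ be an $n\times n$ positive semidefinite matrix (real symmetric or complex Hermitian). For $T\subseteq[n]=\{1,\dots,n\}$ let $A_T$ denote the principal minor of $A$ with rows and columns indexed by $T$; it is a real number. Write $Sab=S\cup\{a,b\}$ and $Sa=S\cup\{a\}$. (1) For any pairwise distinct $i,j,k,l\in[n]$ (so $n\ge4$), any $S\subseteq[n]\setminus\{i,j,k,l\}$ and any $r\in\mathbb R$, $$(r+1)\,A_{Sil}A_{Sjk}+r(r+1)\,A_{Sik}A_{Sjl}\ \ge\ r\,A_{Sij}A_{Skl}.$$ (2) For any pairwise distinct $i,j,k\in[n]$ (so $n\ge3$), any $S\subseteq[n]\setminus\{i,j,k\}$ and any $r\in\mathbb R$, $$(r+1)\,A_{Si}A_{Sjk}+r(r+1)\,A_{Sj}A_{Sik}\ \ge\ r\,A_{Sk}A_{Sij}.$$ Moreover, both inequalities are tight, for all such $n$, indices and $S$ and every $r\in\mathbb R$, over $\mathbb R$ as well as over $\mathbb C$: (3) there is a positive semidefinite matrix $A$ for which equality holds in (1) and the three products are normalized by $A_{Sil}A_{Sjk}+A_{Sik}A_{Sjl}+A_{Sij}A_{Skl}=1$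 (in particular they are not all zero); (4) equality in (2) is attained in the limit: for every $\varepsilon>0$ there is a positive semidefinite matrix $A$ with $A_{Si}A_{Sjk}+A_{Sj}A_{Sik}+A_{Sk}A_{Sij}=1$ and $$(r+1)\,A_{Si}A_{Sjk}+r(r+1)\,A_{Sj}A_{Sik}\ <\ r\,A_{Sk}A_{Sij}+\varepsilon.$$ -/

import Mathlib

open scoped ComplexOrder

/-- The principal minor `A_T`: the determinant of the submatrix of `A` with rows and columns in `T`.
It is regarded as a real number; for Hermitian `A` nothing is lost, see `coe_principalMinor`. -/
noncomputable def principalMinor {𝕜 : Type*} [RCLike 𝕜] {n : ℕ}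
    (A : Matrix (Fin n) (Fin n) 𝕜) (T : Finset (Fin n)) : ℝ :=
  RCLike.re (A.submatrix (fun t : T => (t : Fin n)) (fun t : T => (t : Fin n))).det

/-- The principal minors of a Hermitian matrix are real. -/
theorem coe_principalMinor {𝕜 : Type*} [RCLike 𝕜] {n : ℕ}
    {A : Matrix (Fin n) (Fin n) 𝕜} (hA : A.IsHermitian) (T : Finset (Fin n)) :
    ((principalMinor A T : ℝ) : 𝕜) =
      (A.submatrix (fun t : T => (t : Fin n)) (fun t : T => (t : Fin n))).det := by
  unfold principalMinor
  apply RCLike.conj_eq_iff_re.mp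
  have h := (hA.submatrix (fun t : T => (t : Fin n))).eq
  have h2 := congrArg Matrix.det h
  rw [Matrix.det_conjTranspose] at h2
  exact h2

/-! For positive definite `A`, Schur complementation gives `A_{S∪T} = A_S · det M_T` with `M`
positive semidefinite, so the four-index case concerns the `2 × 2` minors `m_ab` of `M`. Perturbing
by `t • 1` and letting `t → 0` covers semidefinite `A`.

The matrix `(m_ab)` is `d dᵀ - H`, where `d` is the diagonal of `M` and `H = (|M_ab|²)` is positive
semidefinite by the Schur product theorem. It thus has at most one positive direction, and a reverse
Cauchy–Schwarz inequality holds. With `x = m_il m_jk`, `y = m_ik m_jl`, `z = m_ij m_kl` this yields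
`√z ≤ √x + √y` and its permutations, hence `(x + y - z)² ≤ 4xy` by Heron's identity. That is the
discriminant condition for `y r² + (x + y - z) r + x ≥ 0`, which is the claim.

The three-index case adjoins an orthogonal unit vector as fourth index. Tightness comes from vectors
in a plane, where `√x`, `√y`, `√z` satisfy a Plücker relation up to signs. -/

/-- The reverse Cauchy–Schwarz inequality in the plane spanned by two vectors, for the Lorentzian
form `d ⊗ d - H` with `H` positive semidefinite. -/
theorem reverse_cauchy_schwarz {p q a b c : ℝ}
    (h : ∀ s t : ℝ, 0 ≤ s ^ 2 * a + 2 * s * t * b + t ^ 2 * c) (hp : a < p ^ 2) :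
    (p ^ 2 - a) * (q ^ 2 - c) ≤ (p * q - b) ^ 2 := by
  have ha : 0 ≤ a := by simpa using h 1 0
  have h1 := h q (-p)
  have hp2 : 0 < p ^ 2 := lt_of_le_of_lt ha hp
  -- Gram determinant for `v` and `u = q v - p w`: the rank-one part vanishes on `u`, so the form
  -- there is `-H(u, u) ≤ 0`.
  have h2 : p ^ 2 * ((p ^ 2 - a) * (q ^ 2 - c) - (p * q - b) ^ 2)
      + (p * (p * q - b) - q * (p ^ 2 - a)) ^ 2 ≤ 0 := by
    have h3 := mul_nonneg (sub_nonneg.2 hp.le) h1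
    nlinarith [h3]
  have h4 : p ^ 2 * ((p ^ 2 - a) * (q ^ 2 - c) - (p * q - b) ^ 2) ≤ 0 := by
    linarith [sq_nonneg (p * (p * q - b) - q * (p ^ 2 - a))]
  by_contra! hc
  exact absurd h4 (not_le.2 (mul_pos hp2 (sub_pos.2 hc)))

/-- If `c < 0`, the vertex `-c / (2m)` is an admissible `t`; if also `m = 0`, the function is linear
and eventually negative. -/
theorem nonneg_or_sq_le_of_forall_pos {m m' c : ℝ} (hm : 0 ≤ m) (hm' : 0 ≤ m')
    (h : ∀ t : ℝ, 0 < t → 0 ≤ t ^ 2 * m + t * c + m') : 0 ≤ c ∨ c ^ 2 ≤ 4 * (m * m') := by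
  by_contra! hc
  obtain ⟨hc, hlt⟩ := hc
  rcases hm.eq_or_lt with rfl | hm
  · have := h ((m' + 1) / (-c)) (by apply div_pos <;> linarith)
    have h2 : (m' + 1) / (-c) * c = -(m' + 1) := by
      have : c ≠ 0 := hc.ne
      field_simp
    rw [h2] at this
    linarith
  · have := h (-c / (2 * m)) (by apply div_pos <;> linarith)
    have h2 : (-c / (2 * m)) ^ 2 * m + -c / (2 * m) * c + m' = (4 * (m * m') - c ^ 2) / (4 * m) := by
      field_simp
      ring
    rw [h2] at this
    have := div_neg_of_neg_of_pos (sub_neg.2 hlt) (by linarith : 0 < 4 * m)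
    linarith

/-! ### The `2 × 2` minors as a Lorentzian form -/

/-- The `2 × 2` principal minors of a Hermitian matrix. -/
noncomputable def pairMinor {𝕜 ι : Type*} [RCLike 𝕜] (M : Matrix ι ι 𝕜) (a b : ι) : ℝ :=
  RCLike.re (M a a) * RCLike.re (M b b) - ‖M a b‖ ^ 2

section

variable {𝕜 ι : Type*} [RCLike 𝕜] {M : Matrix ι ι 𝕜}

theorem norm_apply_comm (hM : M.PosSemidef) (a b : ι) : ‖M a b‖ = ‖M b a‖ := by
  rw [← hM.isHermitian.apply a b, norm_star]

theorem pairMinor_comm (hM : M.PosSemidef) (a b : ι) : pairMinor M a b = pairMinor M b a := by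
  rw [pairMinor, pairMinor, norm_apply_comm hM, mul_comm (RCLike.re _)]

theorem ofReal_re_diag (hM : M.PosSemidef) (a : ι) : ((RCLike.re (M a a) : ℝ) : 𝕜) = M a a :=
  RCLike.conj_eq_iff_re.mp (hM.isHermitian.apply a a)

theorem re_diag_nonneg (hM : M.PosSemidef) (a : ι) : 0 ≤ RCLike.re (M a a) :=
  (RCLike.nonneg_iff.1 (hM.diag_nonneg (i := a))).1

theorem norm_diag (hM : M.PosSemidef) (a : ι) : ‖M a a‖ = RCLike.re (M a a) := by
  rw [← ofReal_re_diag hM, RCLike.norm_ofReal, RCLike.ofReal_re, abs_of_nonneg (re_diag_nonneg hM a)]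

theorem pairMinor_eq_det (hM : M.PosSemidef) (a b : ι) :
    ((pairMinor M a b : ℝ) : 𝕜) = (M.submatrix ![a, b] ![a, b]).det := by
  rw [Matrix.det_fin_two, pairMinor]
  change _ = M a a * M b b - M a b * M b a
  rw [← hM.isHermitian.apply b a, RCLike.star_def, RCLike.mul_conj]
  rw [RCLike.ofReal_sub, RCLike.ofReal_mul, RCLike.ofReal_pow]
  exact congrArg₂ _ (congrArg₂ _ (ofReal_re_diag hM a) (ofReal_re_diag hM b)) rfl

theorem pairMinor_nonneg (hM : M.PosSemidef) (a b : ι) : 0 ≤ pairMinor M a b := by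
  have := (hM.submatrix ![a, b]).det_nonneg
  rw [← pairMinor_eq_det hM] at this
  exact_mod_cast this

/-- The Schur product of a positive semidefinite matrix with its conjugate is a nonnegative
real quadratic form. -/
theorem sum_norm_sq_nonneg {m : ℕ} (hM : M.PosSemidef) (f : Fin m → ι) (w : Fin m → ℝ) :
    0 ≤ ∑ a, ∑ b, w a * w b * ‖M (f a) (f b)‖ ^ 2 := by
  have h1 := hM.submatrix f
  have h2 := (h1.hadamard h1.transpose).dotProduct_mulVec_nonneg (fun a => (w a : 𝕜))
  have h3 : star (fun a => (w a : 𝕜)) ⬝ᵥ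
      ((M.submatrix f f).hadamard (M.submatrix f f).transpose).mulVec (fun a => (w a : 𝕜)) =
      ((∑ a, ∑ b, w a * w b * ‖M (f a) (f b)‖ ^ 2 : ℝ) : 𝕜) := by
    simp only [dotProduct, Matrix.mulVec, Finset.mul_sum]
    push_cast
    refine Finset.sum_congr rfl fun a _ => Finset.sum_congr rfl fun b _ => ?_
    simp only [Pi.star_apply, RCLike.star_def, RCLike.conj_ofReal, Matrix.hadamard_apply,
      Matrix.submatrix_apply, Matrix.transpose_apply]
    rw [← hM.isHermitian.apply (f b) (f a), ← RCLike.mul_conj]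
    simp only [RCLike.star_def]
    ring
  rw [h3] at h2
  exact_mod_cast h2

/-- Reverse Cauchy–Schwarz for `α e_i + e_j` and `γ e_k + e_l`; the squares `m_aa` vanish, leaving
only `2α m_ij` and `2γ m_kl` on the left. -/
theorem pairMinor_reverse_cauchy_schwarz (hM : M.PosSemidef) (i j k l : ι) {α : ℝ} (γ : ℝ)
    (hα : 0 < α) (hij : 0 < pairMinor M i j) :
    4 * α * γ * (pairMinor M i j * pairMinor M k l) ≤
      (α * γ * pairMinor M i k + α * pairMinor M i l + γ * pairMinor M j k
        + pairMinor M j l) ^ 2 := by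
  have h := reverse_cauchy_schwarz
    (p := α * RCLike.re (M i i) + RCLike.re (M j j)) (q := γ * RCLike.re (M k k) + RCLike.re (M l l))
    (a := α ^ 2 * ‖M i i‖ ^ 2 + 2 * α * ‖M i j‖ ^ 2 + ‖M j j‖ ^ 2)
    (b := α * γ * ‖M i k‖ ^ 2 + α * ‖M i l‖ ^ 2 + γ * ‖M j k‖ ^ 2 + ‖M j l‖ ^ 2)
    (c := γ ^ 2 * ‖M k k‖ ^ 2 + 2 * γ * ‖M k l‖ ^ 2 + ‖M l l‖ ^ 2) ?_ ?_
  · rw [norm_diag hM, norm_diag hM, norm_diag hM, norm_diag hM] at h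
    unfold pairMinor at *
    convert h using 1 <;> ring
  · intro s t
    have h := sum_norm_sq_nonneg hM ![i, j, k, l] ![s * α, s, t * γ, t]
    simp [Fin.sum_univ_four, norm_apply_comm hM j i, norm_apply_comm hM k i,
      norm_apply_comm hM l i, norm_apply_comm hM k j, norm_apply_comm hM l j,
      norm_apply_comm hM l k] at h
    linarith
  · rw [norm_diag hM, norm_diag hM]
    unfold pairMinor at hij
    nlinarith [mul_pos hα hij]

/-- Ptolemy's inequality for the square roots of the `2 × 2` principal minors, without roots. -/
theorem pairMinor_ptolemy (hM : M.PosSemidef) (i j k l : ι) :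
    0 ≤ pairMinor M i l * pairMinor M j k + pairMinor M i k * pairMinor M j l
        - pairMinor M i j * pairMinor M k l ∨
    (pairMinor M i l * pairMinor M j k + pairMinor M i k * pairMinor M j l
        - pairMinor M i j * pairMinor M k l) ^ 2 ≤
      4 * ((pairMinor M i l * pairMinor M j k) * (pairMinor M i k * pairMinor M j l)) := by
  have hn := pairMinor_nonneg hM
  rcases (hn i j).eq_or_lt with hij | hij
  · left
    rw [← hij]
    have := mul_nonneg (hn i l) (hn j k)
    have := mul_nonneg (hn i k) (hn j l)
    linarith
  rcases (hn k l).eq_or_lt with hkl | hkl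
  · left
    rw [← hkl]
    have := mul_nonneg (hn i l) (hn j k)
    have := mul_nonneg (hn i k) (hn j l)
    linarith
  have key : ∀ t : ℝ, 0 < t → 0 ≤ t ^ 2 * (pairMinor M i k * pairMinor M i l) +
      t * (pairMinor M i l * pairMinor M j k + pairMinor M i k * pairMinor M j l
        - pairMinor M i j * pairMinor M k l) + pairMinor M j k * pairMinor M j l := by
    intro t ht
    -- The inequality holds for every real `γ`, so its discriminant in `γ` is nonpositive;
    -- cancelling `t m_ij m_kl > 0` leaves `t m_ij m_kl ≤ (t m_ik + m_jk)(t m_il + m_jl)`.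
    have hd := discrim_le_zero (a := (t * pairMinor M i k + pairMinor M j k) ^ 2)
      (b := 2 * (t * pairMinor M i k + pairMinor M j k) * (t * pairMinor M i l + pairMinor M j l)
        - 4 * t * (pairMinor M i j * pairMinor M k l))
      (c := (t * pairMinor M i l + pairMinor M j l) ^ 2) (fun g => by
        have := pairMinor_reverse_cauchy_schwarz hM i j k l g ht hij
        linarith)
    have hz := mul_pos ht (mul_pos hij hkl)
    have : (t * (pairMinor M i j * pairMinor M k l)) * (t * (pairMinor M i j * pairMinor M k l)
        - (t * pairMinor M i k + pairMinor M j k) * (t * pairMinor M i l + pairMinor M j l)) ≤ 0 := by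
      unfold discrim at hd
      linarith
    have := nonpos_of_mul_nonpos_right this hz
    linarith
  have := nonneg_or_sq_le_of_forall_pos (mul_nonneg (hn i k) (hn i l))
    (mul_nonneg (hn j k) (hn j l)) key
  refine this.imp id fun h => h.trans (le_of_eq (by ring))

theorem pairMinor_four_index (hM : M.PosSemidef) (i j k l : ι) (r : ℝ) :
    0 ≤ (r + 1) * (pairMinor M i l * pairMinor M j k) +
      r * (r + 1) * (pairMinor M i k * pairMinor M j l) -
      r * (pairMinor M i j * pairMinor M k l) := by
  have hn := pairMinor_nonneg hM
  have h1 := pairMinor_ptolemy hM i j k l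
  have h2 := pairMinor_ptolemy hM i k j l
  have h3 := pairMinor_ptolemy hM i l k j
  rw [pairMinor_comm hM l j, pairMinor_comm hM k j] at *
  have hx := mul_nonneg (hn i l) (hn j k)
  have hy := mul_nonneg (hn i k) (hn j l)
  have hz := mul_nonneg (hn i j) (hn k l)
  rw [pairMinor_comm hM l k] at *
  generalize pairMinor M i l * pairMinor M j k = x at *
  generalize pairMinor M i k * pairMinor M j l = y at *
  generalize pairMinor M i j * pairMinor M k l = z at *
  -- `4xy - (x + y - z)²` is symmetric in `x, y, z`, so any one of the three Ptolemy alternatives of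
  -- squared type suffices.
  have hD : (x + y - z) ^ 2 ≤ 4 * (x * y) := by
    rcases h1 with h1 | h1
    · rcases h2 with h2 | h2
      · rcases h3 with h3 | h3
        · rcases le_total x y with h | h <;> rcases le_total y z with h' | h' <;>
            rcases le_total x z with h'' | h'' <;> nlinarith
        · linarith
      · linarith
    · exact h1
  rcases hy.eq_or_lt with rfl | hy
  · have : x - z = 0 := by
      have : (x - z) ^ 2 ≤ 0 := by linarith
      exact pow_eq_zero_iff two_ne_zero |>.1 (le_antisymm this (sq_nonneg _))
    obtain rfl : x = z := by linarith
    linarith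
  · by_contra! hc
    nlinarith [sq_nonneg (2 * y * r + (x + y - z)), mul_neg_of_pos_of_neg hy hc]

/-- In `M ⊕ 1` the minor of `a` with the new index is `M a a`. -/
theorem pairMinor_three_index [Fintype ι] (hM : M.PosSemidef) (i j k : ι) (r : ℝ) :
    0 ≤ (r + 1) * (RCLike.re (M i i) * pairMinor M j k) +
      r * (r + 1) * (RCLike.re (M j j) * pairMinor M i k) -
      r * (RCLike.re (M k k) * pairMinor M i j) := by
  have hN : (Matrix.fromBlocks M 0
      (Matrix.conjTranspose 0) (1 : Matrix (Fin 1) (Fin 1) 𝕜)).PosSemidef := by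
    have : Invertible (1 : Matrix (Fin 1) (Fin 1) 𝕜) := invertibleOne
    rw [Matrix.PosDef.fromBlocks₂₂ _ _ Matrix.PosDef.one]
    simpa using hM
  have := pairMinor_four_index hN (Sum.inl i) (Sum.inl j) (Sum.inl k) (Sum.inr 0) r
  simp only [pairMinor, Matrix.fromBlocks_apply₁₁, Matrix.fromBlocks_apply₁₂,
    Matrix.fromBlocks_apply₂₂, Matrix.one_apply_eq, Matrix.zero_apply, RCLike.one_re, norm_zero]
    at this
  unfold pairMinor
  linarith

end

/-! ### Schur complements and passage to the semidefinite case -/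

section

variable {𝕜 : Type*} [RCLike 𝕜] {n : ℕ}

theorem principalMinor_union_image {m : ℕ} (A : Matrix (Fin n) (Fin n) 𝕜) (S : Finset (Fin n))
    {f : Fin m → Fin n} (hf : Function.Injective f) (hS : ∀ x, f x ∉ S) :
    principalMinor A (S ∪ Finset.univ.image f) =
      RCLike.re (A.submatrix (Sum.elim (fun t : S => (t : Fin n)) f)
        (Sum.elim (fun t : S => (t : Fin n)) f)).det := by
  let g : S ⊕ Fin m → ↥(S ∪ Finset.univ.image f) :=
    Sum.elim (fun t => ⟨t, Finset.mem_union_left _ t.2⟩)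
      (fun x => ⟨f x, Finset.mem_union_right _ (Finset.mem_image_of_mem f (Finset.mem_univ x))⟩)
  have hg : Function.Bijective g := by
    constructor
    · rintro (a | a) (b | b) h
      · have h' := congrArg Subtype.val h
        exact congrArg Sum.inl (Subtype.ext h')
      · have h' : (a : Fin n) = f b := Subtype.ext_iff.1 h
        exact absurd (h' ▸ a.2) (hS b)
      · have h' : f a = (b : Fin n) := Subtype.ext_iff.1 h
        exact absurd (h' ▸ b.2) (hS a)
      · exact congrArg Sum.inr (hf (Subtype.ext_iff.1 h))
    · rintro ⟨x, hx⟩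
      rcases Finset.mem_union.1 hx with h | h
      · exact ⟨Sum.inl ⟨x, h⟩, rfl⟩
      · obtain ⟨y, -, rfl⟩ := Finset.mem_image.1 h
        exact ⟨Sum.inr y, rfl⟩
  have hc : (fun t : ↥(S ∪ Finset.univ.image f) => (t : Fin n)) ∘ g =
      Sum.elim (fun t : S => (t : Fin n)) f := by
    funext x
    cases x <;> rfl
  rw [principalMinor, ← Matrix.det_submatrix_equiv_self (Equiv.ofBijective g hg),
    Matrix.submatrix_submatrix]
  exact congrArg (fun h => RCLike.re (A.submatrix h h).det) hc

/-- The Schur complement of the principal submatrix indexed by `S`, as a matrix indexed by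
everything. -/
noncomputable def schurComplement (A : Matrix (Fin n) (Fin n) 𝕜) (S : Finset (Fin n)) :
    Matrix (Fin n) (Fin n) 𝕜 :=
  A - A.submatrix id (fun t : S => (t : Fin n)) *
    (A.submatrix (fun t : S => (t : Fin n)) (fun t : S => (t : Fin n)))⁻¹ *
    A.submatrix (fun t : S => (t : Fin n)) id

theorem posSemidef_schurComplement {A : Matrix (Fin n) (Fin n) 𝕜} (hA : A.PosDef)
    (S : Finset (Fin n)) : (schurComplement A S).PosSemidef := by
  have h1 : (A.submatrix (fun t : S => (t : Fin n)) (fun t : S => (t : Fin n))).PosDef :=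
    hA.submatrix Subtype.val_injective
  have : Invertible (A.submatrix (fun t : S => (t : Fin n)) (fun t : S => (t : Fin n))) :=
    h1.isUnit.invertible
  have h2 : (A.submatrix (fun t : S => (t : Fin n)) id).conjTranspose =
      A.submatrix id (fun t : S => (t : Fin n)) := by
    rw [Matrix.conjTranspose_submatrix, hA.isHermitian.eq]
  have h3 := (Matrix.PosDef.fromBlocks₁₁ (A.submatrix (fun t : S => (t : Fin n)) id) A h1).1 (by
    -- The indices in `S` occur twice, which is harmless: semidefiniteness survives repeated rows
    -- and columns.
    have h4 : Matrix.fromBlocks (A.submatrix (fun t : S => (t : Fin n)) (fun t : S => (t : Fin n)))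
        (A.submatrix (fun t : S => (t : Fin n)) id) (A.submatrix id (fun t : S => (t : Fin n))) A =
        A.submatrix (Sum.elim (fun t : S => (t : Fin n)) id)
          (Sum.elim (fun t : S => (t : Fin n)) id) := by
      ext (a | a) (b | b) <;> rfl
    rw [h2, h4]
    exact hA.posSemidef.submatrix _)
  rwa [h2] at h3

theorem principalMinor_union_image_eq_mul {m : ℕ} {A : Matrix (Fin n) (Fin n) 𝕜} (hA : A.PosDef)
    (S : Finset (Fin n)) {f : Fin m → Fin n} (hf : Function.Injective f) (hS : ∀ x, f x ∉ S) :
    principalMinor A (S ∪ Finset.univ.image f) =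
      principalMinor A S * RCLike.re ((schurComplement A S).submatrix f f).det := by
  have h1 : (A.submatrix (fun t : S => (t : Fin n)) (fun t : S => (t : Fin n))).PosDef :=
    hA.submatrix Subtype.val_injective
  have : Invertible (A.submatrix (fun t : S => (t : Fin n)) (fun t : S => (t : Fin n))) :=
    h1.isUnit.invertible
  have h2 : A.submatrix (Sum.elim (fun t : S => (t : Fin n)) f)
      (Sum.elim (fun t : S => (t : Fin n)) f) = Matrix.fromBlocks
        (A.submatrix (fun t : S => (t : Fin n)) (fun t : S => (t : Fin n)))
        (A.submatrix (fun t : S => (t : Fin n)) f) (A.submatrix f (fun t : S => (t : Fin n)))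
        (A.submatrix f f) := by
    ext (a | a) (b | b) <;> rfl
  have h3 : (schurComplement A S).submatrix f f = A.submatrix f f -
      A.submatrix f (fun t : S => (t : Fin n)) *
      (A.submatrix (fun t : S => (t : Fin n)) (fun t : S => (t : Fin n)))⁻¹ *
      A.submatrix (fun t : S => (t : Fin n)) f := rfl
  rw [principalMinor_union_image A S hf hS, h2, Matrix.det_fromBlocks₁₁, h3,
    Matrix.invOf_eq_nonsing_inv, ← coe_principalMinor hA.isHermitian, RCLike.re_ofReal_mul]

theorem image_vec_one (a : Fin n) : Finset.univ.image ![a] = {a} := by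
  ext; simp [eq_comm]

theorem image_vec_two (a b : Fin n) : Finset.univ.image ![a, b] = {a, b} := by
  ext; simp [eq_comm]

theorem injective_vec_one (a : Fin n) : Function.Injective ![a] :=
  Function.injective_of_subsingleton _

theorem injective_vec_two {a b : Fin n} (hab : a ≠ b) : Function.Injective ![a, b] := by
  intro x y h
  fin_cases x <;> fin_cases y <;> simp_all

theorem principalMinor_union_pair {A : Matrix (Fin n) (Fin n) 𝕜} (hA : A.PosDef)
    {S : Finset (Fin n)} {a b : Fin n} (hab : a ≠ b) (ha : a ∉ S) (hb : b ∉ S) :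
    principalMinor A (S ∪ {a, b}) =
      principalMinor A S * pairMinor (schurComplement A S) a b := by
  rw [← image_vec_two, principalMinor_union_image_eq_mul hA S (injective_vec_two hab)
    (by simp [Fin.forall_fin_two, ha, hb]),
    ← pairMinor_eq_det (posSemidef_schurComplement hA S), RCLike.ofReal_re]

theorem principalMinor_union_singleton {A : Matrix (Fin n) (Fin n) 𝕜} (hA : A.PosDef)
    {S : Finset (Fin n)} {a : Fin n} (ha : a ∉ S) :
    principalMinor A (S ∪ {a}) =
      principalMinor A S * RCLike.re (schurComplement A S a a) := by
  rw [← image_vec_one, principalMinor_union_image_eq_mul hA S (injective_vec_one a)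
    (by simp [ha]), Matrix.det_fin_one]
  rfl

theorem tendsto_principalMinor_add_smul_one (A : Matrix (Fin n) (Fin n) 𝕜) (T : Finset (Fin n)) :
    Filter.Tendsto (fun t : ℝ => principalMinor (A + (t : 𝕜) • 1) T)
      (nhdsWithin 0 (Set.Ioi 0)) (nhds (principalMinor A T)) := by
  have hc : Continuous fun t : ℝ => principalMinor (A + (t : 𝕜) • 1) T := by
    unfold principalMinor
    refine RCLike.continuous_re.comp (Continuous.matrix_det (Continuous.matrix_submatrix ?_ _ _))
    exact continuous_const.add ((RCLike.continuous_ofReal (K := 𝕜)).smul (continuous_const (y := (1 : Matrix (Fin n) (Fin n) 𝕜))))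
  have := (hc.tendsto 0).mono_left (nhdsWithin_le_nhds (s := Set.Ioi 0))
  simpa using this

theorem posDef_add_smul_one {A : Matrix (Fin n) (Fin n) 𝕜} (hA : A.PosSemidef) {t : ℝ}
    (ht : 0 < t) : (A + (t : 𝕜) • 1).PosDef :=
  Matrix.PosDef.posSemidef_add hA (Matrix.PosDef.one.smul (by exact_mod_cast ht))

theorem principalMinor_four_index_of_posDef {A : Matrix (Fin n) (Fin n) 𝕜} (hA : A.PosDef)
    {i j k l : Fin n} (hd : [i, j, k, l].Nodup) {S : Finset (Fin n)}
    (hS : Disjoint S {i, j, k, l}) (r : ℝ) :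
    r * (principalMinor A (S ∪ {i, j}) * principalMinor A (S ∪ {k, l})) ≤
      (r + 1) * (principalMinor A (S ∪ {i, l}) * principalMinor A (S ∪ {j, k})) +
        r * (r + 1) * (principalMinor A (S ∪ {i, k}) * principalMinor A (S ∪ {j, l})) := by
  simp only [Finset.disjoint_insert_right, Finset.disjoint_singleton_right] at hS
  obtain ⟨hi, hj, hk, hl⟩ := hS
  simp only [List.nodup_cons, List.mem_cons, List.not_mem_nil, or_false, not_or,
    not_false_eq_true, List.nodup_nil, and_true] at hd
  obtain ⟨⟨hij, hik, hil⟩, ⟨hjk, hjl⟩, hkl⟩ := hd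
  rw [principalMinor_union_pair hA hij hi hj, principalMinor_union_pair hA hkl hk hl,
    principalMinor_union_pair hA hil hi hl, principalMinor_union_pair hA hjk hj hk,
    principalMinor_union_pair hA hik hi hk, principalMinor_union_pair hA hjl hj hl]
  have := mul_nonneg (sq_nonneg (principalMinor A S))
    (pairMinor_four_index (posSemidef_schurComplement hA S) i j k l r)
  linarith

theorem principalMinor_three_index_of_posDef {A : Matrix (Fin n) (Fin n) 𝕜} (hA : A.PosDef)
    {i j k : Fin n} (hd : [i, j, k].Nodup) {S : Finset (Fin n)}
    (hS : Disjoint S {i, j, k}) (r : ℝ) :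
    r * (principalMinor A (S ∪ {k}) * principalMinor A (S ∪ {i, j})) ≤
      (r + 1) * (principalMinor A (S ∪ {i}) * principalMinor A (S ∪ {j, k})) +
        r * (r + 1) * (principalMinor A (S ∪ {j}) * principalMinor A (S ∪ {i, k})) := by
  simp only [Finset.disjoint_insert_right, Finset.disjoint_singleton_right] at hS
  obtain ⟨hi, hj, hk⟩ := hS
  simp only [List.nodup_cons, List.mem_cons, List.not_mem_nil, or_false, not_or,
    not_false_eq_true, List.nodup_nil, and_true] at hd
  obtain ⟨⟨hij, hik⟩, hjk⟩ := hd
  rw [principalMinor_union_pair hA hij hi hj, principalMinor_union_pair hA hjk hj hk,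
    principalMinor_union_pair hA hik hi hk, principalMinor_union_singleton hA hi,
    principalMinor_union_singleton hA hj, principalMinor_union_singleton hA hk]
  have := mul_nonneg (sq_nonneg (principalMinor A S))
    (pairMinor_three_index (posSemidef_schurComplement hA S) i j k r)
  linarith

theorem principalMinor_four_index {A : Matrix (Fin n) (Fin n) 𝕜} (hA : A.PosSemidef)
    {i j k l : Fin n} (hd : [i, j, k, l].Nodup) {S : Finset (Fin n)}
    (hS : Disjoint S {i, j, k, l}) (r : ℝ) :
    r * (principalMinor A (S ∪ {i, j}) * principalMinor A (S ∪ {k, l})) ≤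
      (r + 1) * (principalMinor A (S ∪ {i, l}) * principalMinor A (S ∪ {j, k})) +
        r * (r + 1) * (principalMinor A (S ∪ {i, k}) * principalMinor A (S ∪ {j, l})) := by
  have ht := tendsto_principalMinor_add_smul_one A
  exact le_of_tendsto_of_tendsto (((ht _).mul (ht _)).const_mul _)
    ((((ht _).mul (ht _)).const_mul _).add (((ht _).mul (ht _)).const_mul _))
    (Filter.eventually_of_mem self_mem_nhdsWithin fun t h =>
      principalMinor_four_index_of_posDef (posDef_add_smul_one hA h) hd hS r)

theorem principalMinor_three_index {A : Matrix (Fin n) (Fin n) 𝕜} (hA : A.PosSemidef)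
    {i j k : Fin n} (hd : [i, j, k].Nodup) {S : Finset (Fin n)}
    (hS : Disjoint S {i, j, k}) (r : ℝ) :
    r * (principalMinor A (S ∪ {k}) * principalMinor A (S ∪ {i, j})) ≤
      (r + 1) * (principalMinor A (S ∪ {i}) * principalMinor A (S ∪ {j, k})) +
        r * (r + 1) * (principalMinor A (S ∪ {j}) * principalMinor A (S ∪ {i, k})) := by
  have ht := tendsto_principalMinor_add_smul_one A
  exact le_of_tendsto_of_tendsto (((ht _).mul (ht _)).const_mul _)
    ((((ht _).mul (ht _)).const_mul _).add (((ht _).mul (ht _)).const_mul _))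
    (Filter.eventually_of_mem self_mem_nhdsWithin fun t h =>
      principalMinor_three_index_of_posDef (posDef_add_smul_one hA h) hd hS r)

/-! ### Extremal plane configurations -/

/-- The identity on `S` plus the Gram matrix of the plane vectors `(p a, q a)`. -/
noncomputable def gramPlane (𝕜 : Type*) [RCLike 𝕜] (p q : Fin n → ℝ) (S : Finset (Fin n)) :
    Matrix (Fin n) (Fin n) 𝕜 :=
  Matrix.vecMulVec (fun a => (p a : 𝕜)) (star fun a => (p a : 𝕜)) +
    Matrix.vecMulVec (fun a => (q a : 𝕜)) (star fun a => (q a : 𝕜)) +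
    Matrix.diagonal fun a => if a ∈ S then 1 else 0

theorem posSemidef_gramPlane (p q : Fin n → ℝ) (S : Finset (Fin n)) :
    (gramPlane 𝕜 p q S).PosSemidef :=
  ((Matrix.posSemidef_vecMulVec_self_star _).add (Matrix.posSemidef_vecMulVec_self_star _)).add
    (Matrix.PosSemidef.diagonal fun a => by
      change (0 : 𝕜) ≤ if a ∈ S then 1 else 0
      split_ifs
      · exact zero_le_one
      · exact le_rfl)

theorem gramPlane_apply (p q : Fin n → ℝ) (S : Finset (Fin n)) (a b : Fin n) :
    gramPlane 𝕜 p q S a b =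
      ((p a * p b + q a * q b + if a = b ∧ a ∈ S then 1 else 0 : ℝ) : 𝕜) := by
  by_cases hab : a = b <;> by_cases ha : a ∈ S <;>
    simp_all [gramPlane, Matrix.vecMulVec_apply]

theorem principalMinor_gramPlane {m : ℕ} {p q : Fin n → ℝ} {S : Finset (Fin n)}
    (hp : ∀ a ∈ S, p a = 0) (hq : ∀ a ∈ S, q a = 0)
    {f : Fin m → Fin n} (hf : Function.Injective f) (hS : ∀ x, f x ∉ S) :
    principalMinor (gramPlane 𝕜 p q S) (S ∪ Finset.univ.image f) =
      RCLike.re ((gramPlane 𝕜 p q S).submatrix f f).det := by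
  have h : (gramPlane 𝕜 p q S).submatrix (Sum.elim (fun t : S => (t : Fin n)) f)
      (Sum.elim (fun t : S => (t : Fin n)) f) =
      Matrix.fromBlocks 1 0 0 ((gramPlane 𝕜 p q S).submatrix f f) := by
    ext (a | a) (b | b)
    · rcases eq_or_ne a b with rfl | hab
      · simp [gramPlane_apply, hp, hq]
      · have : (a : Fin n) ≠ b := fun h => hab (Subtype.ext h)
        simp [gramPlane_apply, hp, hq, this, hab]
    · have : (a : Fin n) ≠ f b := fun h => hS b (h ▸ a.2)
      simp [gramPlane_apply, hp, hq, this]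
    · simp [gramPlane_apply, hp, hq, hS]
    · rfl
  rw [principalMinor_union_image _ S hf hS, h, Matrix.det_fromBlocks_zero₁₂, Matrix.det_one,
    one_mul]

theorem principalMinor_gramPlane_pair {p q : Fin n → ℝ} {S : Finset (Fin n)}
    (hp : ∀ a ∈ S, p a = 0) (hq : ∀ a ∈ S, q a = 0)
    {a b : Fin n} (hab : a ≠ b) (ha : a ∉ S) (hb : b ∉ S) :
    principalMinor (gramPlane 𝕜 p q S) (S ∪ {a, b}) = (p a * q b - p b * q a) ^ 2 := by
  rw [← image_vec_two, principalMinor_gramPlane hp hq (injective_vec_two hab)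
    (by simp [Fin.forall_fin_two, ha, hb]), ← pairMinor_eq_det (posSemidef_gramPlane p q S),
    RCLike.ofReal_re, pairMinor]
  simp only [gramPlane_apply, RCLike.ofReal_re, RCLike.norm_ofReal, sq_abs, hab, ha, hb,
    and_false, if_false]
  ring

theorem principalMinor_gramPlane_singleton {p q : Fin n → ℝ} {S : Finset (Fin n)}
    (hp : ∀ a ∈ S, p a = 0) (hq : ∀ a ∈ S, q a = 0) {a : Fin n} (ha : a ∉ S) :
    principalMinor (gramPlane 𝕜 p q S) (S ∪ {a}) = p a ^ 2 + q a ^ 2 := by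
  rw [← image_vec_one, principalMinor_gramPlane hp hq (injective_vec_one a) (by simp [ha]),
    Matrix.det_fin_one]
  change RCLike.re (gramPlane 𝕜 p q S a a) = _
  rw [gramPlane_apply, RCLike.ofReal_re]
  simp [ha]
  ring

/-- Plane vectors with prescribed values at four indices. -/
theorem exists_fun_four {i j k l : Fin n} (hd : [i, j, k, l].Nodup) {S : Finset (Fin n)}
    (hS : Disjoint S {i, j, k, l}) (a b c d : ℝ) :
    ∃ p : Fin n → ℝ, (∀ x ∈ S, p x = 0) ∧ p i = a ∧ p j = b ∧ p k = c ∧ p l = d := by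
  simp only [Finset.disjoint_insert_right, Finset.disjoint_singleton_right] at hS
  obtain ⟨hi, hj, hk, hl⟩ := hS
  simp only [List.nodup_cons, List.mem_cons, List.not_mem_nil, or_false, not_or,
    not_false_eq_true, List.nodup_nil, and_true] at hd
  obtain ⟨⟨hij, hik, hil⟩, ⟨hjk, hjl⟩, hkl⟩ := hd
  refine ⟨fun x => if x = i then a else if x = j then b else if x = k then c else
    if x = l then d else 0, fun x hx => ?_, ?_, ?_, ?_, ?_⟩
  · have h1 : x ≠ i := fun h => hi (h ▸ hx)
    have h2 : x ≠ j := fun h => hj (h ▸ hx)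
    have h3 : x ≠ k := fun h => hk (h ▸ hx)
    have h4 : x ≠ l := fun h => hl (h ▸ hx)
    simp [h1, h2, h3, h4]
  · simp
  · simp [Ne.symm hij]
  · simp [Ne.symm hik, Ne.symm hjk]
  · simp [Ne.symm hil, Ne.symm hjl, Ne.symm hkl]

/-- Values prescribed at three indices. -/
theorem exists_fun_three {i j k : Fin n} (hd : [i, j, k].Nodup) {S : Finset (Fin n)}
    (hS : Disjoint S {i, j, k}) (a b c : ℝ) :
    ∃ p : Fin n → ℝ, (∀ x ∈ S, p x = 0) ∧ p i = a ∧ p j = b ∧ p k = c := by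
  simp only [Finset.disjoint_insert_right, Finset.disjoint_singleton_right] at hS
  obtain ⟨hi, hj, hk⟩ := hS
  simp only [List.nodup_cons, List.mem_cons, List.not_mem_nil, or_false, not_or,
    not_false_eq_true, List.nodup_nil, and_true] at hd
  obtain ⟨⟨hij, hik⟩, hjk⟩ := hd
  refine ⟨fun x => if x = i then a else if x = j then b else if x = k then c else 0,
    fun x hx => ?_, ?_, ?_, ?_⟩
  · have h1 : x ≠ i := fun h => hi (h ▸ hx)
    have h2 : x ≠ j := fun h => hj (h ▸ hx)
    have h3 : x ≠ k := fun h => hk (h ▸ hx)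
    simp [h1, h2, h3]
  · simp
  · simp [Ne.symm hij]
  · simp [Ne.symm hik, Ne.symm hjk]

theorem exists_four_index_eq (𝕜 : Type*) [RCLike 𝕜] {i j k l : Fin n} (hd : [i, j, k, l].Nodup)
    {S : Finset (Fin n)} (hS : Disjoint S {i, j, k, l}) (r : ℝ) :
    ∃ A : Matrix (Fin n) (Fin n) 𝕜, A.PosSemidef ∧
      principalMinor A (S ∪ {i, l}) * principalMinor A (S ∪ {j, k}) +
        principalMinor A (S ∪ {i, k}) * principalMinor A (S ∪ {j, l}) +
        principalMinor A (S ∪ {i, j}) * principalMinor A (S ∪ {k, l}) = 1 ∧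
      (r + 1) * (principalMinor A (S ∪ {i, l}) * principalMinor A (S ∪ {j, k})) +
          r * (r + 1) * (principalMinor A (S ∪ {i, k}) * principalMinor A (S ∪ {j, l})) =
        r * (principalMinor A (S ∪ {i, j}) * principalMinor A (S ∪ {k, l})) := by
  have hN : 0 < r ^ 2 + 1 + (1 + r) ^ 2 := by positivity
  obtain ⟨c, hc⟩ : ∃ c : ℝ, c ^ 2 * (r ^ 2 + 1 + (1 + r) ^ 2) = 1 :=
    ⟨√(r ^ 2 + 1 + (1 + r) ^ 2)⁻¹, by rw [Real.sq_sqrt (by positivity), inv_mul_cancel₀ hN.ne']⟩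
  -- These vectors give `(x, y, z) = c² (r², 1, (r+1)²)`, for which `r` is the double root of the
  -- quadratic.
  obtain ⟨p, hp, hpi, hpj, hpk, hpl⟩ := exists_fun_four hd hS c (-r) 0 (-r - 1)
  obtain ⟨q, hq, hqi, hqj, hqk, hql⟩ := exists_fun_four hd hS 0 1 1 1
  refine ⟨gramPlane 𝕜 p q S, posSemidef_gramPlane p q S, ?_⟩
  simp only [Finset.disjoint_insert_right, Finset.disjoint_singleton_right] at hS
  obtain ⟨hi, hj, hk, hl⟩ := hS
  simp only [List.nodup_cons, List.mem_cons, List.not_mem_nil, or_false, not_or,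
    not_false_eq_true, List.nodup_nil, and_true] at hd
  obtain ⟨⟨hij, hik, hil⟩, ⟨hjk, hjl⟩, hkl⟩ := hd
  rw [principalMinor_gramPlane_pair hp hq hij hi hj, principalMinor_gramPlane_pair hp hq hkl hk hl,
    principalMinor_gramPlane_pair hp hq hil hi hl, principalMinor_gramPlane_pair hp hq hjk hj hk,
    principalMinor_gramPlane_pair hp hq hik hi hk, principalMinor_gramPlane_pair hp hq hjl hj hl,
    hpi, hpj, hpk, hpl, hqi, hqj, hqk, hql]
  constructor
  · linarith
  · ring

theorem exists_three_index_lt (𝕜 : Type*) [RCLike 𝕜] {i j k : Fin n} (hd : [i, j, k].Nodup)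
    {S : Finset (Fin n)} (hS : Disjoint S {i, j, k}) (r : ℝ) {ε : ℝ} (hε : 0 < ε) :
    ∃ A : Matrix (Fin n) (Fin n) 𝕜, A.PosSemidef ∧
      principalMinor A (S ∪ {i}) * principalMinor A (S ∪ {j, k}) +
        principalMinor A (S ∪ {j}) * principalMinor A (S ∪ {i, k}) +
        principalMinor A (S ∪ {k}) * principalMinor A (S ∪ {i, j}) = 1 ∧
      (r + 1) * (principalMinor A (S ∪ {i}) * principalMinor A (S ∪ {j, k})) +
          r * (r + 1) * (principalMinor A (S ∪ {j}) * principalMinor A (S ∪ {i, k})) <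
        r * (principalMinor A (S ∪ {k}) * principalMinor A (S ∪ {i, j})) + ε := by
  have hK : 0 < r ^ 2 * (r + 1) ^ 2 + 1 := by positivity
  obtain ⟨δ, hδ, hδε⟩ : ∃ δ : ℝ, 0 < δ ∧ δ ^ 2 * (r ^ 2 * (r + 1) ^ 2 + 1) = ε :=
    ⟨√(ε / (r ^ 2 * (r + 1) ^ 2 + 1)), by positivity, by
      rw [Real.sq_sqrt (by positivity), div_mul_cancel₀ _ hK.ne']⟩
  have hN : 0 < r ^ 2 + 1 + (1 + r) ^ 2 + 2 * δ ^ 2 * r ^ 2 := by positivity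
  obtain ⟨c, hc⟩ : ∃ c : ℝ,
      c ^ 2 * δ ^ 2 * (r ^ 2 + 1 + (1 + r) ^ 2 + 2 * δ ^ 2 * r ^ 2) = 1 :=
    ⟨√(δ ^ 2 * (r ^ 2 + 1 + (1 + r) ^ 2 + 2 * δ ^ 2 * r ^ 2))⁻¹, by
      rw [Real.sq_sqrt (by positivity), mul_assoc, inv_mul_cancel₀ (by positivity)]⟩
  -- Nearly parallel vectors: as `δ → 0` the products approach the ratio `r² : 1 : (r+1)²`, and the
  -- defect is exactly `c² δ⁴ r² (r+1)²`.
  obtain ⟨p, hp, hpi, hpj, hpk⟩ := exists_fun_three hd hS c 1 1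
  obtain ⟨q, hq, hqi, hqj, hqk⟩ := exists_fun_three hd hS (c * δ) (-r * δ) 0
  refine ⟨gramPlane 𝕜 p q S, posSemidef_gramPlane p q S, ?_⟩
  simp only [Finset.disjoint_insert_right, Finset.disjoint_singleton_right] at hS
  obtain ⟨hi, hj, hk⟩ := hS
  simp only [List.nodup_cons, List.mem_cons, List.not_mem_nil, or_false, not_or,
    not_false_eq_true, List.nodup_nil, and_true] at hd
  obtain ⟨⟨hij, hik⟩, hjk⟩ := hd
  rw [principalMinor_gramPlane_pair hp hq hij hi hj, principalMinor_gramPlane_pair hp hq hjk hj hk,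
    principalMinor_gramPlane_pair hp hq hik hi hk, principalMinor_gramPlane_singleton hp hq hi,
    principalMinor_gramPlane_singleton hp hq hj, principalMinor_gramPlane_singleton hp hq hk,
    hpi, hpj, hpk, hqi, hqj, hqk]
  constructor
  · linarith
  · have h1 : c ^ 2 * δ ^ 2 ≤ 1 := by
      rw [← hc]
      refine le_mul_of_one_le_right (by positivity) ?_
      linarith [sq_nonneg r, sq_nonneg (1 + r), mul_nonneg (sq_nonneg δ) (sq_nonneg r)]
    have h2 : δ ^ 2 * (r ^ 2 * (r + 1) ^ 2) < ε := by
      rw [← hδε]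
      linarith [pow_pos hδ 2]
    have h3 := (mul_le_of_le_one_left
      (by positivity : 0 ≤ δ ^ 2 * (r ^ 2 * (r + 1) ^ 2)) h1).trans_lt h2
    linarith

end

theorem mainTheorem5 (𝕜 : Type*) [RCLike 𝕜] (n : ℕ) :
    -- the inequality for four indices
    (∀ (A : Matrix (Fin n) (Fin n) 𝕜), A.PosSemidef →
      ∀ i j k l : Fin n, [i, j, k, l].Nodup →
      ∀ S : Finset (Fin n), Disjoint S {i, j, k, l} → ∀ r : ℝ,
        (r + 1) * (principalMinor A (S ∪ {i, l}) * principalMinor A (S ∪ {j, k})) +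
            r * (r + 1) * (principalMinor A (S ∪ {i, k}) * principalMinor A (S ∪ {j, l})) ≥
          r * (principalMinor A (S ∪ {i, j}) * principalMinor A (S ∪ {k, l}))) ∧
    -- the inequality for three indices
    (∀ (A : Matrix (Fin n) (Fin n) 𝕜), A.PosSemidef →
      ∀ i j k : Fin n, [i, j, k].Nodup →
      ∀ S : Finset (Fin n), Disjoint S {i, j, k} → ∀ r : ℝ,
        (r + 1) * (principalMinor A (S ∪ {i}) * principalMinor A (S ∪ {j, k})) +
            r * (r + 1) * (principalMinor A (S ∪ {j}) * principalMinor A (S ∪ {i, k})) ≥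
          r * (principalMinor A (S ∪ {k}) * principalMinor A (S ∪ {i, j}))) ∧
    -- tightness for four indices: equality is attained, with the three products not all zero
    (∀ i j k l : Fin n, [i, j, k, l].Nodup →
      ∀ S : Finset (Fin n), Disjoint S {i, j, k, l} → ∀ r : ℝ,
      ∃ A : Matrix (Fin n) (Fin n) 𝕜, A.PosSemidef ∧
        principalMinor A (S ∪ {i, l}) * principalMinor A (S ∪ {j, k}) +
          principalMinor A (S ∪ {i, k}) * principalMinor A (S ∪ {j, l}) +
          principalMinor A (S ∪ {i, j}) * principalMinor A (S ∪ {k, l}) = 1 ∧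
        (r + 1) * (principalMinor A (S ∪ {i, l}) * principalMinor A (S ∪ {j, k})) +
            r * (r + 1) * (principalMinor A (S ∪ {i, k}) * principalMinor A (S ∪ {j, l})) =
          r * (principalMinor A (S ∪ {i, j}) * principalMinor A (S ∪ {k, l}))) ∧
    -- tightness for three indices: equality is approached, with the three products normalized
    (∀ i j k : Fin n, [i, j, k].Nodup →
      ∀ S : Finset (Fin n), Disjoint S {i, j, k} → ∀ r : ℝ, ∀ ε : ℝ, 0 < ε →
      ∃ A : Matrix (Fin n) (Fin n) 𝕜, A.PosSemidef ∧
        principalMinor A (S ∪ {i}) * principalMinor A (S ∪ {j, k}) +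
          principalMinor A (S ∪ {j}) * principalMinor A (S ∪ {i, k}) +
          principalMinor A (S ∪ {k}) * principalMinor A (S ∪ {i, j}) = 1 ∧
        (r + 1) * (principalMinor A (S ∪ {i}) * principalMinor A (S ∪ {j, k})) +
            r * (r + 1) * (principalMinor A (S ∪ {j}) * principalMinor A (S ∪ {i, k})) <
          r * (principalMinor A (S ∪ {k}) * principalMinor A (S ∪ {i, j})) + ε) := by
  exact ⟨fun _ hA _ _ _ _ hd _ hS r => principalMinor_four_index hA hd hS r,
    fun _ hA _ _ _ hd _ hS r => principalMinor_three_index hA hd hS r,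
    fun _ _ _ _ hd _ hS r => exists_four_index_eq 𝕜 hd hS r,
    fun _ _ _ hd _ hS r _ hε => exists_three_index_lt 𝕜 hd hS r hε⟩
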